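/- Let $B$ be a Polish (complete separable) metric space. A $B$-field is a $1$-Lipschitz map $\pi_X\colon X\to B$ from a Polish metric space $X$; an isometric embedding of fields $X\to Y$ over $B$ is an isometric embedding $\iota\colon X\to Y$ with $\pi_Y\circ\iota=\pi_X$. A $B$-field $\pi_U\colon U\to B$ is a *Urysohn field* if for every finite $A\subseteq U$, every one-point metric extension $A^*=A\sqcup\{a^*\}$ and every $1$-Lipschitz $\phi\colon A^*\to B$ with $\phi|_A=\pi_U|_A$ there is an isometric embedding $\imath\colon A^*\to U$ with $\imath|_A$ the inclusion and $\pi_U\circ\imath=\phi$. An $mm$-field over $B$ is a $B$-field with a Borel probability measure $\mu_X$ on $X$; it is compact if $X$ is compact, and fully supported if $\operatorname{supp}\mu_X=X$. Two $mm$-fields are isomorphic if there is a measure-preserving bijective isometry over $B$ between them. For $mm$-fields $\mathcal X,\mathcal Y$ let $$d_{GW,\infty}(\mathcal X,\mathcal Y)=\inf_{\gamma}\max\Big\{\tfrac12\sup_{(x,y),(x',y')\in\operatorname{supp}\gamma}|d_X(x,x')-d_Y(y,y')|,\ \sup_{(x,y)\in\operatorname{supp}\gamma}d_B(\pi_X(x),\pi_Y(y))\Big\},$$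 and for probability measures $\mu,\nu$ on $U$ let $d_{W,\infty}(\mu,\nu)=\inf_\gamma\sup_{(x,y)\in\operatorname{supp}\gamma}d_U(x,y)$, where $\gamma$ runs over all couplings of $\mu_X,\mu_Y$, respectively of $\mu,\nu$. **Theorem.** Let $U$ be a Urysohn field over $B$, let $G_B$ be its group of automorphisms (bijective isometries $g$ of $U$ with $\pi_U\circ g=\pi_U$), and let $\mathcal L_B$ be the set of compactly supported Borel probability measures on $U$, on which $G_B$ acts by $g\cdot\mu=g_*\mu$. Let $\mathcal I_B$ be the set of isomorphism classes of compact fully supported $mm$-fields over $B$. Then: 1. $d_{GW,\infty}$ induces a metric on $\mathcal I_B$, and $d_{W,\infty}$ is a metric on $\mathcal L_B$. The quotient metric $d$ on $\mathcal L_B/G_B$ (the largest pseudometric for which the quotient map is $1$-Lipschitz) is a metric, and $$d([\mu],[\nu])=\inf_{g\in G_B}d_{W,\infty}(\mu,g_*\nu).$$ 2. $(\mathcal I_B,d_{GW,\infty})$ is isometric to $(\mathcal L_B/G_B,d)$: every compact $mm$-field over $B$ embeds isometrically into $U$ over $B$, and there is a bijective isometry $\Psi\colon\mathcal I_B\to\mathcal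 L_B/G_B$ with $\Psi([\mathcal X])=[\iota_*\mu_X]$ for every isometric embedding $\iota\colon X\to U$ over $B$. 3. For all compact $mm$-fields $\mathcal X,\mathcal Y$ over $B$, fully supported or not, and all isometric embeddings $\iota\colon X\to U$, $\kappa\colon Y\to U$ over $B$, $d([\iota_*\mu_X],[\kappa_*\mu_Y])=d_{GW,\infty}(\mathcal X,\mathcal Y)$. -/

import Mathlib

open MeasureTheory TopologicalSpace
open scoped ENNReal

universe u v w

noncomputable section

/-- A `B`-field: a `1`-Lipschitz map `proj` from a complete separable metric space to `B`. -/
structure BField (B : Type u) [MetricSpace B] where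
  carrier : Type v
  [metric : MetricSpace carrier]
  [complete : CompleteSpace carrier]
  [separable : SeparableSpace carrier]
  proj : carrier → B
  lipschitz : LipschitzWith 1 proj

namespace BField

variable {B : Type u} [MetricSpace B]

instance : CoeSort (BField.{u, v} B) (Type v) := ⟨BField.carrier⟩

instance (X : BField.{u, v} B) : MetricSpace X := X.metric
instance (X : BField.{u, v} B) : CompleteSpace X := X.complete
instance (X : BField.{u, v} B) : SeparableSpace X := X.separable
instance (X : BField.{u, v} B) : SecondCountableTopology X :=
  UniformSpace.secondCountable_of_separable X
instance (X : BField.{u, v} B) : MeasurableSpace X := borel X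
instance (X : BField.{u, v} B) : BorelSpace X := ⟨rfl⟩

/-- `ι` is an isometric embedding of `X` into `Y` over `B`. -/
structure IsEmbedding (X : BField.{u, v} B) (Y : BField.{u, w} B) (ι : X → Y) : Prop where
  isometry : Isometry ι
  proj_comp : ∀ x, Y.proj (ι x) = X.proj x

/-- The one-point extension property. The one-point metric extensions of a subspace `A` are the
metrics on `Option A = A ⊔ {none}` that restrict to the given metric on `A`. -/
def IsUrysohn (U : BField.{u, v} B) : Prop :=
  ∀ (A : Set U), A.Finite → ∀ [MetricSpace (Option A)], Isometry (some : A → Option A) →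
    ∀ φ : Option A → B, LipschitzWith 1 φ → (∀ a : A, φ (some a) = U.proj a) →
      ∃ ι : Option A → U, Isometry ι ∧ (∀ a : A, ι (some a) = a) ∧ ∀ z, U.proj (ι z) = φ z

/-- The automorphism group: bijective self-isometries that commute with the projection to `B`. -/
def Aut (U : BField.{u, v} B) : Subgroup (U ≃ᵢ U) where
  carrier := {g | ∀ x, U.proj (g x) = U.proj x}
  mul_mem' := by
    intro g h hg hh x
    exact (hg (h x)).trans (hh x)
  one_mem' := fun _ => rfl
  inv_mem' := by
    intro g hg x
    have h := hg (g⁻¹ x)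
    rw [IsometryEquiv.apply_inv_self] at h
    exact h.symm

end BField

/-- `γ` is a coupling of `μ` and `ν`. -/
def IsCoupling {X : Type v} {Y : Type w} [MeasurableSpace X] [MeasurableSpace Y]
    (γ : Measure (X × Y)) (μ : Measure X) (ν : Measure Y) : Prop :=
  γ.map Prod.fst = μ ∧ γ.map Prod.snd = ν

/-- A compactly supported law: a probability measure whose topological support is compact. -/
@[ext]
structure CompactLaw (E : Type v) [TopologicalSpace E] [MeasurableSpace E] where
  law : Measure E
  prob : IsProbabilityMeasure law
  compact_support : IsCompact law.support

/-- The `∞`-Wasserstein distance. -/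
def wassersteinInf {E : Type v} [MetricSpace E] [MeasurableSpace E] (μ ν : Measure E) : ℝ≥0∞ :=
  ⨅ (γ : Measure (E × E)) (_ : IsCoupling γ μ ν), ⨆ p ∈ γ.support, edist p.1 p.2

/-- An `mm`-field over `B`: a `B`-field with a Borel probability measure on its domain. -/
structure MMField (B : Type u) [MetricSpace B] where
  toBField : BField.{u, v} B
  law : Measure toBField
  prob : IsProbabilityMeasure law

/-- A compact `mm`-field: the domain is compact. -/
structure CompactMMField (B : Type u) [MetricSpace B] where
  toMMField : MMField.{u, v} B
  compact : CompactSpace toMMField.toBField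

/-- The `B`-field underlying a compact `mm`-field. -/
abbrev CompactMMField.toBField {B : Type u} [MetricSpace B] (X : CompactMMField.{u, v} B) :
    BField.{u, v} B :=
  X.toMMField.toBField

/-- The measure of a compact `mm`-field. -/
abbrev CompactMMField.law {B : Type u} [MetricSpace B] (X : CompactMMField.{u, v} B) :
    Measure X.toBField :=
  X.toMMField.law

namespace MMField

variable {B : Type u} [MetricSpace B]

/-- The `∞`-Gromov-Wasserstein distance between `mm`-fields. -/
def gromovWassersteinInf (X : MMField.{u, v} B) (Y : MMField.{u, w} B) : ℝ≥0∞ :=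
  ⨅ (γ : Measure (X.toBField × Y.toBField)) (_ : IsCoupling γ X.law Y.law),
    max (2⁻¹ * ⨆ p ∈ γ.support, ⨆ q ∈ γ.support,
          ENNReal.ofReal |dist p.1 q.1 - dist p.2 q.2|)
      (⨆ p ∈ γ.support, edist (X.toBField.proj p.1) (Y.toBField.proj p.2))

/-- Isomorphism of `mm`-fields: a measure-preserving bijective isometry over `B`. -/
def Iso (X : MMField.{u, v} B) (Y : MMField.{u, w} B) : Prop :=
  ∃ e : X.toBField ≃ᵢ Y.toBField,
    (∀ x, Y.toBField.proj (e x) = X.toBField.proj x) ∧ X.law.map e = Y.law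

theorem Iso.refl (X : MMField.{u, v} B) : X.Iso X :=
  ⟨IsometryEquiv.refl _, fun _ => rfl, Measure.map_id⟩

theorem Iso.symm {X : MMField.{u, v} B} {Y : MMField.{u, w} B} (h : X.Iso Y) : Y.Iso X := by
  obtain ⟨e, he, hm⟩ := h
  refine ⟨e.symm, fun y => ?_, ?_⟩
  · rw [← he (e.symm y), e.apply_symm_apply]
  · rw [← hm, Measure.map_map e.symm.continuous.measurable e.continuous.measurable]
    have : (e.symm ∘ e : X.toBField → X.toBField) = id := funext e.symm_apply_apply
    rw [this, Measure.map_id]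

theorem Iso.trans {X Y Z : MMField.{u, v} B} (h : X.Iso Y) (h' : Y.Iso Z) : X.Iso Z := by
  obtain ⟨e, he, hm⟩ := h
  obtain ⟨f, hf, hn⟩ := h'
  refine ⟨e.trans f, fun x => (hf (e x)).trans (he x), ?_⟩
  rw [← hn, ← hm, Measure.map_map f.continuous.measurable e.continuous.measurable]
  rfl

end MMField

/-- A compact `mm`-field is fully supported if the support of its law is the whole domain. -/
def CompactMMField.FullySupported {B : Type u} [MetricSpace B]
    (X : CompactMMField.{u, v} B) : Prop :=
  X.law.support = Set.univ

/-- Isomorphism as an equivalence relation on compact fully supported `mm`-fields. -/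
def mmSetoid (B : Type u) [MetricSpace B] :
    Setoid {X : CompactMMField.{u, v} B // X.FullySupported} where
  r X Y := X.1.toMMField.Iso Y.1.toMMField
  iseqv := ⟨fun X => MMField.Iso.refl X.1.toMMField, fun h => h.symm, fun h h' => h.trans h'⟩

/-- The moduli space: isomorphism classes of compact fully supported `mm`-fields over `B`. -/
def MMModuli (B : Type u) [MetricSpace B] : Type (max u (v + 1)) :=
  Quotient (mmSetoid.{u, v} B)

/-- The class of a compact fully supported `mm`-field in the moduli space. -/
def MMModuli.mk {B : Type u} [MetricSpace B] (X : CompactMMField.{u, v} B)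
    (hX : X.FullySupported) : MMModuli.{u, v} B :=
  Quotient.mk (mmSetoid.{u, v} B) ⟨X, hX⟩

/-- Pushforward of a compactly supported law along a continuous map. -/
def CompactLaw.map {E : Type v} {F : Type w} [MetricSpace E] [SecondCountableTopology E]
    [MeasurableSpace E] [BorelSpace E] [MetricSpace F] [MeasurableSpace F] [BorelSpace F]
    (f : E → F) (hf : Continuous f) (μ : CompactLaw E) : CompactLaw F where
  law := μ.law.map f
  prob := by
    have := μ.prob
    exact Measure.isProbabilityMeasure_map hf.measurable.aemeasurable
  compact_support := by
    have hK : IsCompact (f '' μ.law.support) := μ.compact_support.image hf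
    refine hK.of_isClosed_subset Measure.isClosed_support
      (Measure.support_subset_of_isClosed hK.isClosed ?_)
    rw [mem_ae_iff, Measure.map_apply hf.measurable hK.isClosed.measurableSet.compl]
    refine measure_mono_null ?_ (Measure.measure_compl_support (μ := μ.law))
    intro x hx hx'
    exact hx ⟨x, hx', rfl⟩

/-- The law of a compact `mm`-field, as a compactly supported law. -/
def CompactMMField.compactLaw {B : Type u} [MetricSpace B] (X : CompactMMField.{u, v} B) :
    CompactLaw X.toBField where
  law := X.law
  prob := X.toMMField.prob
  compact_support := by
    have : CompactSpace X.toBField := X.compact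
    exact Measure.isClosed_support.isCompact

/-- Automorphisms act on compactly supported laws by pushforward. -/
instance {B : Type u} [MetricSpace B] (U : BField.{u, v} B) : MulAction U.Aut (CompactLaw U) where
  smul g μ := μ.map g.1 g.1.continuous
  one_smul _ := CompactLaw.ext (Measure.map_id (μ := CompactLaw.law _))
  mul_smul g h _ := CompactLaw.ext
    (Measure.map_map g.1.continuous.measurable h.1.continuous.measurable).symm

/-- The orbit space of compactly supported laws under the automorphism group. -/
abbrev LawOrbits {B : Type u} [MetricSpace B] (U : BField.{u, v} B) : Type v :=
  MulAction.orbitRel.Quotient U.Aut (CompactLaw U)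

/-- The orbit of a compactly supported law. -/
def LawOrbits.mk {B : Type u} [MetricSpace B] {U : BField.{u, v} B} (μ : CompactLaw U) :
    LawOrbits U :=
  Quotient.mk (MulAction.orbitRel U.Aut (CompactLaw U)) μ

/-- The quotient distance on `Quotient s` of a distance `d`: the pointwise supremum of all
pseudometrics for which the quotient map is `1`-Lipschitz (this is the maximal one). -/
def quotientEDist {α : Type v} (s : Setoid α) (d : α → α → ℝ≥0∞) (a b : Quotient s) : ℝ≥0∞ :=
  ⨆ (p : PseudoEMetricSpace (Quotient s))
    (_ : ∀ x y : α, p.edist (Quotient.mk s x) (Quotient.mk s y) ≤ d x y), p.edist a b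

end

/-! Two properties of a Urysohn field carry the theorem: every field embeds into it, and two
embeddings of a compact field differ by an automorphism. For both, the extension property is first
upgraded from finite to compact sets, by correcting approximate realizations into a Cauchy sequence.
Countably many one-point extensions, in one direction or back and forth, then give a partial
isometry whose closure is an embedding or an automorphism.

The distance `gromovWassersteinInf` is the infimum of `wassersteinInf` over pairs of embeddings into
`U`. A coupling of two laws on `U` carried by the embedded copies pulls back to the fields.
Conversely, a coupling with distortion at most `2r` and base displacement at most `r` allows the two
fields to be glued at distance `r` along its support, and the glued field embeds into `U`. By
homogeneity, varying the embeddings amounts to varying an automorphism, so this infimum is the orbit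
distance (`iInf_wassersteinInf_eq`).

For an isometric action the orbit distance is the quotient distance. It separates orbits because
they are closed: near-optimal automorphisms converge along an ultrafilter on the compact support,
and the limit extends to an automorphism. A fully supported field is recovered from its embedded law
as the support of that law, which gives the bijection. -/

/-! ### Extension properties of Urysohn fields -/

namespace BField

variable {B : Type u} [MetricSpace B]

/-- A Urysohn field realizes every Katetov function on a finite set, over any admissible point
of the base. -/
theorem IsUrysohn.exists_dist_eq_of_finite {U : BField.{u, v} B} (hU : U.IsUrysohn)
    {A : Set U} (hA : A.Finite) (f : U → ℝ) (b : B)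
    (hf : ∀ a ∈ A, ∀ a' ∈ A, f a ≤ dist a a' + f a')
    (hf' : ∀ a ∈ A, ∀ a' ∈ A, dist a a' ≤ f a + f a')
    (hb : ∀ a ∈ A, dist b (U.proj a) ≤ f a) :
    ∃ x : U, U.proj x = b ∧ ∀ a ∈ A, dist x a = f a := by
  -- A one-point extension has positive distances to the new point. If `f` vanishes at `a`, then `a`
  -- lies over `b` by `hb` and itself realizes `f`.
  by_cases h : ∃ a ∈ A, f a ≤ 0
  · obtain ⟨a, ha, h0⟩ := h
    refine ⟨a, ?_, fun a' ha' => ?_⟩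
    · exact (dist_le_zero.1 ((hb a ha).trans h0)).symm
    · have h1 := hf a' ha' a ha
      have h2 := hf' a ha a' ha'
      rw [dist_comm] at h1
      linarith
  push Not at h
  let m : MetricSpace (Option A) :=
    { dist := fun x y => match x, y with
        | none, none => 0
        | some a, some a' => dist a a'
        | some a, none => f a
        | none, some a => f a
      dist_self := by rintro (_ | a) <;> simp
      dist_comm := by rintro (_ | a) (_ | a') <;> simp [dist_comm]
      dist_triangle := by
        rintro (_ | a) (_ | a') (_ | a'')
        · simp
        · simp
        · have := h a' a'.2
          simp only
          linarith
        · have := hf a'' a''.2 a' a'.2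
          rw [dist_comm] at this
          simpa [Subtype.dist_eq, add_comm] using this
        · simp
        · simpa [Subtype.dist_eq] using hf' a a.2 a'' a''.2
        · simpa [Subtype.dist_eq] using hf a a.2 a' a'.2
        · simpa [Subtype.dist_eq] using dist_triangle (a : U) a' a''
      eq_of_dist_eq_zero := by
        rintro (_ | a) (_ | a') h0
        · rfl
        · exact absurd h0 (h a' a'.2).ne'
        · exact absurd h0 (h a a.2).ne'
        · exact congrArg some (eq_of_dist_eq_zero h0) }
  obtain ⟨i, hi, hia, hip⟩ := hU A hA (Isometry.of_dist_eq fun _ _ => rfl)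
    (fun z => z.elim b fun a => U.proj a) (by
      refine LipschitzWith.of_dist_le_mul ?_
      rintro (_ | a) (_ | a')
      · simp
      · rw [NNReal.coe_one, one_mul]; exact hb a' a'.2
      · rw [NNReal.coe_one, one_mul, dist_comm]; exact hb a a.2
      · exact U.lipschitz.dist_le_mul a a') (fun _ => rfl)
  refine ⟨i none, hip none, fun a ha => ?_⟩
  have := hi.dist_eq none (some ⟨a, ha⟩)
  rwa [hia] at this

/-- A point that approximately realizes a Katetov function on a finite set is close to a point
that realizes it exactly. -/
theorem IsUrysohn.exists_dist_eq_near {U : BField.{u, v} B} (hU : U.IsUrysohn)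
    {A : Set U} (hA : A.Finite) (f : U → ℝ) (b : B)
    (hf : ∀ a ∈ A, ∀ a' ∈ A, f a ≤ dist a a' + f a')
    (hf' : ∀ a ∈ A, ∀ a' ∈ A, dist a a' ≤ f a + f a')
    (hb : ∀ a ∈ A, dist b (U.proj a) ≤ f a)
    {x : U} (hx : U.proj x = b) {δ : ℝ} (hδ : 0 ≤ δ) (hxf : ∀ a ∈ A, |dist x a - f a| ≤ δ) :
    ∃ y : U, U.proj y = b ∧ (∀ a ∈ A, dist y a = f a) ∧ dist x y ≤ δ := by
  classical
  rcases A.eq_empty_or_nonempty with rfl | hne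
  · exact ⟨x, hx, by simp, by simpa using hδ⟩
  have hf0 : ∀ a ∈ A, 0 ≤ f a := fun a ha => dist_nonneg.trans (hb a ha)
  -- Here the distance to `x` is already prescribed as `f x`, which is at most `δ` because `dist x x
  -- = 0`.
  by_cases hxA : x ∈ A
  · obtain ⟨y, hy, hya⟩ := hU.exists_dist_eq_of_finite hA f b hf hf' hb
    refine ⟨y, hy, hya, ?_⟩
    have := hxf x hxA
    rwa [dist_self, zero_sub, abs_neg, abs_of_nonneg (hf0 x hxA), ← hya x hxA, dist_comm] at this
  -- The point `x` is adjoined to `A` with the maximal error `t` as its prescribed distance, the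
  -- least value compatible with `f`. The bound `δ` itself could violate `t ≤ dist x a + f a`.
  obtain ⟨c, hc, hmax⟩ := hA.exists_maximalFor (fun a => |dist x a - f a|) A hne
  replace hmax : ∀ a ∈ A, |dist x a - f a| ≤ |dist x c - f c| := fun a ha => by
    rcases le_total (|dist x a - f a|) (|dist x c - f c|) with h | h
    · exact h
    · exact hmax ha h
  set t := |dist x c - f c| with ht
  let g : U → ℝ := Function.update f x t
  have gx : g x = t := Function.update_self ..
  have ga : ∀ a ∈ A, g a = f a := fun a ha =>
    Function.update_of_ne (fun h : a = x => hxA (h ▸ ha)) ..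
  have htop : ∀ a ∈ A, t ≤ dist x a + f a := by
    intro a ha
    have h1 := hf c hc a ha
    have h2 := hf' c hc a ha
    have h3 := dist_triangle x a c
    have h4 := dist_triangle_left c a x
    rw [dist_comm a c] at h3
    rw [ht, abs_le']
    constructor <;> linarith
  have hlow : ∀ a ∈ A, dist x a ≤ t + f a ∧ f a ≤ t + dist x a := by
    intro a ha
    have := abs_le.1 (hmax a ha)
    constructor <;> linarith
  obtain ⟨y, hy, hya⟩ := hU.exists_dist_eq_of_finite (hA.insert x) g b (by
      rintro a (rfl | ha) a' (rfl | ha')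
      · simp
      · rw [gx, ga a' ha']; exact htop a' ha'
      · rw [gx, ga a ha, dist_comm]; linarith [(hlow a ha).2]
      · rw [ga a ha, ga a' ha']; exact hf a ha a' ha') (by
      rintro a (rfl | ha) a' (rfl | ha')
      · rw [dist_self, gx]; positivity
      · rw [gx, ga a' ha']; exact (hlow a' ha').1
      · rw [gx, ga a ha, dist_comm, add_comm]; exact (hlow a ha).1
      · rw [ga a ha, ga a' ha']; exact hf' a ha a' ha') (by
      rintro a (rfl | ha)
      · rw [gx, hx, dist_self]; positivity
      · rw [ga a ha]; exact hb a ha)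
  refine ⟨y, hy, fun a ha => ?_, ?_⟩
  · rw [hya a (Set.mem_insert_of_mem _ ha), ga a ha]
  · rw [dist_comm, hya x (Set.mem_insert _ _), gx]
    exact hxf c hc

/-- A Urysohn field realizes every Katetov function on a compact set. -/
theorem IsUrysohn.exists_dist_eq_of_isCompact {U : BField.{u, v} B} (hU : U.IsUrysohn)
    {A : Set U} (hA : IsCompact A) (f : U → ℝ) (b : B)
    (hf : ∀ a ∈ A, ∀ a' ∈ A, f a ≤ dist a a' + f a')
    (hf' : ∀ a ∈ A, ∀ a' ∈ A, dist a a' ≤ f a + f a')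
    (hb : ∀ a ∈ A, dist b (U.proj a) ≤ f a) :
    ∃ x : U, U.proj x = b ∧ ∀ a ∈ A, dist x a = f a := by
  -- The nets need not be nested. As `f` and `dist x` are `1`-Lipschitz on `A`, a point exact on the
  -- `n`-th net errs by at most `2 * (1 / 2) ^ n` on `A`, in particular on the next net; it can
  -- therefore be corrected by a move of that size within the fiber over `b`.
  have hnet : ∀ n : ℕ, ∃ t ⊆ A, t.Finite ∧ A ⊆ ⋃ x ∈ t, Metric.ball x ((1 / 2 : ℝ) ^ n) :=
    fun n => hA.finite_cover_balls (by positivity)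
  choose t htA htfin htcov using hnet
  have hclose : ∀ n x, (∀ a ∈ t n, dist x a = f a) → ∀ a ∈ A,
      |dist x a - f a| ≤ 2 * (1 / 2 : ℝ) ^ n := by
    intro n x hx a ha
    obtain ⟨c, hc, hac⟩ := Set.mem_iUnion₂.1 (htcov n ha)
    have h0 := hx c hc
    have h1 := hf a ha c (htA n hc)
    have h2 := hf c (htA n hc) a ha
    have h3 := dist_triangle x c a
    have h4 := dist_triangle x a c
    rw [Metric.mem_ball] at hac
    rw [dist_comm c a] at h2 h3
    rw [abs_le]
    constructor <;> linarith
  let P : ℕ → Type v := fun n => {x : U // U.proj x = b ∧ ∀ a ∈ t n, dist x a = f a}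
  have hstep : ∀ n (x : P n), ∃ y : P (n + 1), dist x.1 y.1 ≤ 2 * (1 / 2 : ℝ) ^ n := by
    intro n x
    have hs := htA (n + 1)
    obtain ⟨y, hy, hya, hxy⟩ := hU.exists_dist_eq_near (htfin (n + 1)) f b
      (fun a ha a' ha' => hf a (hs ha) a' (hs ha'))
      (fun a ha a' ha' => hf' a (hs ha) a' (hs ha')) (fun a ha => hb a (hs ha)) x.2.1
      (δ := 2 * (1 / 2 : ℝ) ^ n) (by positivity) fun a ha => hclose n x.1 x.2.2 a (hs ha)
    exact ⟨⟨y, hy, hya⟩, hxy⟩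
  choose next hnext using hstep
  obtain ⟨x₀, hx₀⟩ := hU.exists_dist_eq_of_finite (htfin 0) f b
    (fun a ha a' ha' => hf a (htA 0 ha) a' (htA 0 ha'))
    (fun a ha a' ha' => hf' a (htA 0 ha) a' (htA 0 ha')) (fun a ha => hb a (htA 0 ha))
  let s : ∀ n, P n := fun n => Nat.rec ⟨x₀, hx₀⟩ next n
  have hs : ∀ n, dist (s n).1 (s (n + 1)).1 ≤ 2 * (1 / 2 : ℝ) ^ n := fun n => hnext n (s n)
  obtain ⟨x, hx⟩ := cauchySeq_tendsto_of_complete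
    (cauchySeq_of_le_geometric (1 / 2 : ℝ) 2 (by norm_num) hs)
  refine ⟨x, ?_, fun a ha => ?_⟩
  · refine tendsto_nhds_unique ((U.lipschitz.continuous.tendsto x).comp hx) ?_
    exact tendsto_const_nhds.congr fun n => ((s n).2.1).symm
  · have h1 : Filter.Tendsto (fun n => |dist (s n).1 a - f a|) Filter.atTop
        (nhds |dist x a - f a|) := ((hx.dist tendsto_const_nhds).sub_const _).abs
    have h2 : Filter.Tendsto (fun n : ℕ => 2 * (1 / 2 : ℝ) ^ n) Filter.atTop (nhds (2 * 0)) :=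
      (tendsto_pow_atTop_nhds_zero_of_lt_one (by norm_num) (by norm_num)).const_mul 2
    have h3 := le_of_tendsto_of_tendsto' h1 h2 fun n => hclose n (s n).1 (s n).2.2 a ha
    rw [mul_zero] at h3
    exact sub_eq_zero.1 (abs_eq_zero.1 (le_antisymm h3 (abs_nonneg _)))

/-! ### Partial isometries, universality and homogeneity -/

/-- A partial isometry over `B`, given by its graph. -/
structure IsPartialIso (X : BField.{u, v} B) (Y : BField.{u, w} B) (R : Set (X × Y)) : Prop where
  dist_eq : ∀ p ∈ R, ∀ q ∈ R, dist p.1 q.1 = dist p.2 q.2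
  proj_eq : ∀ p ∈ R, X.proj p.1 = Y.proj p.2

section PartialIso

variable {X : BField.{u, v} B} {Y : BField.{u, w} B} {R : Set (X × Y)}

theorem IsPartialIso.swap (hR : X.IsPartialIso Y R) : Y.IsPartialIso X (Prod.swap ⁻¹' R) where
  dist_eq _ hp _ hq := (hR.dist_eq _ hp _ hq).symm
  proj_eq _ hp := (hR.proj_eq _ hp).symm

theorem IsPartialIso.closure (hR : X.IsPartialIso Y R) : X.IsPartialIso Y (closure R) where
  dist_eq := by
    have hC : IsClosed {z : (X × Y) × (X × Y) | dist z.1.1 z.2.1 = dist z.1.2 z.2.2} :=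
      isClosed_eq (by fun_prop) (by fun_prop)
    intro p hp q hq
    have hsub : R ×ˢ R ⊆ {z : (X × Y) × (X × Y) | dist z.1.1 z.2.1 = dist z.1.2 z.2.2} :=
      fun z hz => hR.dist_eq z.1 hz.1 z.2 hz.2
    have := hC.closure_subset_iff.2 hsub
    rw [closure_prod_eq] at this
    exact this (show (p, q) ∈ _ from ⟨hp, hq⟩)
  proj_eq := by
    have hC : IsClosed {z : X × Y | X.proj z.1 = Y.proj z.2} :=
      isClosed_eq (X.lipschitz.continuous.comp continuous_fst)
        (Y.lipschitz.continuous.comp continuous_snd)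
    exact fun p hp => hC.closure_subset_iff.2 hR.proj_eq hp

/-- A compact partial isometry into a Urysohn field extends to any given point. -/
theorem IsPartialIso.exists_insert (hR : X.IsPartialIso Y R) (hY : Y.IsUrysohn)
    (hc : IsCompact R) (x : X) : ∃ y : Y, X.IsPartialIso Y (insert (x, y) R) := by
  have hg : ∀ y ∈ Prod.snd '' R, ∃ x : X, (x, y) ∈ R := by
    rintro _ ⟨p, hp, rfl⟩
    exact ⟨p.1, hp⟩
  have : Nonempty X := ⟨x⟩
  choose! g hg using hg
  -- The Katetov function is the distance to `x` transported along `R`. The choice of `g` is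
  -- harmless: two points related to the same `y` have distance zero.
  obtain ⟨y, hy, hya⟩ := hY.exists_dist_eq_of_isCompact (hc.image continuous_snd)
    (fun y => dist x (g y)) (X.proj x)
    (fun a ha a' ha' => by
      rw [← hR.dist_eq _ (hg a ha) _ (hg a' ha'), add_comm, dist_comm (g a)]
      exact dist_triangle _ _ _)
    (fun a ha a' ha' => by
      rw [← hR.dist_eq _ (hg a ha) _ (hg a' ha')]
      exact dist_triangle_left _ _ _)
    (fun a ha => by
      rw [← hR.proj_eq _ (hg a ha)]
      simpa using X.lipschitz.dist_le_mul x (g a))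
  have key : ∀ p ∈ R, dist x p.1 = dist y p.2 := by
    intro p hp
    have hp2 : p.2 ∈ Prod.snd '' R := ⟨p, hp, rfl⟩
    have h0 : g p.2 = p.1 := by
      have := hR.dist_eq _ (hg p.2 hp2) _ hp
      rwa [dist_self, dist_eq_zero] at this
    rw [hya _ hp2, h0]
  refine ⟨y, ⟨?_, ?_⟩⟩
  · rintro p (rfl | hp) q (rfl | hq)
    · simp
    · exact key q hq
    · rw [dist_comm, dist_comm p.2]; exact key p hp
    · exact hR.dist_eq p hp q hq
  · rintro p (rfl | hp)
    · exact hy.symm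
    · exact hR.proj_eq p hp

/-- The closure of a partial isometry with dense domain is defined everywhere. -/
theorem IsPartialIso.exists_mem_closure (hR : X.IsPartialIso Y R) (hd : Dense (Prod.fst '' R))
    (x : X) : ∃ y : Y, (x, y) ∈ _root_.closure R := by
  obtain ⟨s, hs, hsx⟩ := mem_closure_iff_seq_limit.1 (hd x)
  choose p hp hps using hs
  have hcau : CauchySeq fun n => (p n).2 := by
    have h1 : CauchySeq s := hsx.cauchySeq
    rw [Metric.cauchySeq_iff] at h1 ⊢
    intro ε hε
    obtain ⟨N, hN⟩ := h1 ε hε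
    refine ⟨N, fun m hm n hn => ?_⟩
    rw [← hR.dist_eq _ (hp m) _ (hp n), hps, hps]
    exact hN m hm n hn
  obtain ⟨y, hy⟩ := cauchySeq_tendsto_of_complete hcau
  refine ⟨y, mem_closure_of_tendsto (f := p) (b := Filter.atTop) ?_ (Filter.Eventually.of_forall hp)⟩
  refine Filter.Tendsto.prodMk_nhds ?_ hy
  simpa only [hps] using hsx

/-- Compact partial isometries over `B` between two fields. -/
def CompactPartialIso (X : BField.{u, v} B) (Y : BField.{u, w} B) : Type (max v w) :=
  {R : Set (X × Y) // IsCompact R ∧ X.IsPartialIso Y R}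

instance : Preorder (CompactPartialIso X Y) := inferInstanceAs (Preorder (Subtype _))

/-- The compact partial isometries whose domain contains a given point are cofinal if the target
is a Urysohn field. -/
def domCofinal (hY : Y.IsUrysohn) (x : X) : Order.Cofinal (CompactPartialIso X Y) where
  carrier := {R | x ∈ Prod.fst '' R.1}
  isCofinal R := by
    obtain ⟨y, hy⟩ := R.2.2.exists_insert hY R.2.1 x
    exact ⟨⟨insert (x, y) R.1, R.2.1.insert _, hy⟩, ⟨(x, y), Set.mem_insert _ _, rfl⟩,
      Set.subset_insert _ _⟩

/-- The compact partial isometries whose range contains a given point are cofinal if the source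
is a Urysohn field. -/
def ranCofinal (hX : X.IsUrysohn) (y : Y) : Order.Cofinal (CompactPartialIso X Y) where
  carrier := {R | y ∈ Prod.snd '' R.1}
  isCofinal R := by
    obtain ⟨x, hx⟩ := R.2.2.swap.exists_insert hX ((Homeomorph.prodComm Y X).isCompact_preimage.2 R.2.1) y
    refine ⟨⟨insert (x, y) R.1, R.2.1.insert _, ?_⟩, ⟨(x, y), Set.mem_insert _ _, rfl⟩,
      Set.subset_insert _ _⟩
    convert hx.swap using 1
    ext ⟨a, b⟩
    simp [and_comm]

/-- The members of an ideal of compact partial isometries have a common extension. -/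
theorem isPartialIso_biUnion (I : Order.Ideal (CompactPartialIso X Y)) :
    X.IsPartialIso Y (⋃ R ∈ I, R.1) where
  dist_eq p hp q hq := by
    obtain ⟨R, hR, hpR⟩ := Set.mem_iUnion₂.1 hp
    obtain ⟨S, hS, hqS⟩ := Set.mem_iUnion₂.1 hq
    obtain ⟨T, -, hRT, hST⟩ := I.directed R hR S hS
    exact T.2.2.dist_eq p (hRT hpR) q (hST hqS)
  proj_eq p hp := by
    obtain ⟨R, -, hpR⟩ := Set.mem_iUnion₂.1 hp
    exact R.2.2.proj_eq p hpR

/-- A partial isometry defined everywhere is the graph of an embedding. -/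
theorem IsPartialIso.isEmbedding (hR : X.IsPartialIso Y R) {f : X → Y}
    (hf : ∀ x, (x, f x) ∈ R) : X.IsEmbedding Y f where
  isometry := Isometry.of_dist_eq fun x x' => (hR.dist_eq _ (hf x) _ (hf x')).symm
  proj_comp x := (hR.proj_eq _ (hf x)).symm

end PartialIso

/-- Every field over `B` embeds into every Urysohn field over `B`. -/
theorem IsUrysohn.exists_isEmbedding {U : BField.{u, v} B} (hU : U.IsUrysohn)
    (X : BField.{u, w} B) : ∃ ι : X → U, X.IsEmbedding U ι := by
  obtain ⟨s, hsc, hsd⟩ := exists_countable_dense X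
  have := hsc.to_subtype
  have := Encodable.ofCountable s
  let R₀ : CompactPartialIso X U := ⟨∅, isCompact_empty, ⟨by simp, by simp⟩⟩
  -- Rasiowa–Sikorski: an ideal meets countably many cofinal sets, one for each point of a dense
  -- sequence. Its union need not be compact, but it is a partial isometry with dense domain.
  let I := Order.idealOfCofinals R₀ fun x : s => domCofinal hU (x : X)
  have hI := isPartialIso_biUnion I
  have hd : Dense (Prod.fst '' ⋃ R ∈ I, R.1) := by
    refine hsd.mono fun x hx => ?_
    obtain ⟨R, ⟨p, hp, hpx⟩, hR⟩ := Order.cofinal_meets_idealOfCofinals R₀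
      (fun x : s => domCofinal hU (x : X)) ⟨x, hx⟩
    exact ⟨p, Set.mem_iUnion₂.2 ⟨R, hR, hp⟩, hpx⟩
  choose f hf using hI.exists_mem_closure hd
  exact ⟨f, hI.closure.isEmbedding hf⟩

/-- A compact partial isometry of a Urysohn field extends to an automorphism. -/
theorem IsUrysohn.exists_aut_of_isPartialIso {U : BField.{u, v} B} (hU : U.IsUrysohn)
    {R : Set (U × U)} (hc : IsCompact R) (hR : U.IsPartialIso U R) :
    ∃ g : U.Aut, ∀ p ∈ R, g.1 p.1 = p.2 := by
  obtain ⟨s, hsc, hsd⟩ := exists_countable_dense U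
  have := hsc.to_subtype
  have := Encodable.ofCountable s
  let R₀ : CompactPartialIso U U := ⟨R, hc, hR⟩
  -- Back and forth: the domain conditions make the closure total, the range conditions make it
  -- surjective.
  let D : s ⊕ s → Order.Cofinal (CompactPartialIso U U) :=
    Sum.elim (fun x => domCofinal hU (x : U)) fun x => ranCofinal hU (x : U)
  let I := Order.idealOfCofinals R₀ D
  have hI := isPartialIso_biUnion I
  have hd : Dense (Prod.fst '' ⋃ R ∈ I, R.1) := by
    refine hsd.mono fun x hx => ?_
    obtain ⟨S, ⟨p, hp, hpx⟩, hS⟩ := Order.cofinal_meets_idealOfCofinals R₀ D (.inl ⟨x, hx⟩)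
    exact ⟨p, Set.mem_iUnion₂.2 ⟨S, hS, hp⟩, hpx⟩
  have hd' : Dense (Prod.fst '' (Prod.swap ⁻¹' ⋃ R ∈ I, R.1)) := by
    refine hsd.mono fun x hx => ?_
    obtain ⟨S, ⟨p, hp, hpx⟩, hS⟩ := Order.cofinal_meets_idealOfCofinals R₀ D (.inr ⟨x, hx⟩)
    exact ⟨p.swap, Set.mem_iUnion₂.2 ⟨S, hS, hp⟩, hpx⟩
  choose f hf using hI.exists_mem_closure hd
  choose f' hf' using hI.swap.exists_mem_closure hd'
  have hf'' : ∀ y, (f' y, y) ∈ closure (⋃ R ∈ I, R.1) := fun y =>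
    map_mem_closure (f := Prod.swap) continuous_swap (hf' y) fun _ h => h
  have hemb := hI.closure.isEmbedding hf
  have huniq : ∀ x y, (x, y) ∈ closure (⋃ R ∈ I, R.1) → f x = y := by
    intro x y hxy
    have := hI.closure.dist_eq _ (hf x) _ hxy
    rwa [dist_self, eq_comm, dist_eq_zero] at this
  refine ⟨⟨IsometryEquiv.mk' f f' (fun y => huniq _ _ (hf'' y)) hemb.isometry, hemb.proj_comp⟩,
    fun p hp => huniq _ _ (subset_closure (Set.mem_iUnion₂.2 ⟨R₀, ?_, hp⟩))⟩
  exact Order.mem_idealOfCofinals _ _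

/-- Two embeddings of a compact field into a Urysohn field differ by an automorphism. -/
theorem IsUrysohn.exists_aut_comp_eq {U : BField.{u, v} B} (hU : U.IsUrysohn)
    {X : BField.{u, w} B} [CompactSpace X] {ι κ : X → U} (hι : X.IsEmbedding U ι)
    (hκ : X.IsEmbedding U κ) : ∃ g : U.Aut, ∀ x, g.1 (ι x) = κ x := by
  obtain ⟨g, hg⟩ := hU.exists_aut_of_isPartialIso (R := Set.range fun x => (ι x, κ x))
    (isCompact_range (hι.isometry.continuous.prodMk hκ.isometry.continuous)) (by
      constructor
      · rintro _ ⟨x, rfl⟩ _ ⟨y, rfl⟩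
        exact (hι.isometry.dist_eq x y).trans (hκ.isometry.dist_eq x y).symm
      · rintro _ ⟨x, rfl⟩
        exact (hι.proj_comp x).trans (hκ.proj_comp x).symm)
  exact ⟨g, fun x => hg _ ⟨x, rfl⟩⟩

end BField

/-! ### Couplings and the `∞`-Wasserstein distance -/

namespace IsCoupling

variable {X Y Z : Type*} [MeasurableSpace X] [MeasurableSpace Y] [MeasurableSpace Z]
  {γ : Measure (X × Y)} {μ : Measure X} {ν : Measure Y}

theorem isProbabilityMeasure (h : IsCoupling γ μ ν) [IsProbabilityMeasure μ] :
    IsProbabilityMeasure γ := by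
  constructor
  rw [← Set.preimage_univ (f := Prod.fst), ← Measure.map_apply measurable_fst .univ, h.1,
    measure_univ]

theorem ae_fst (h : IsCoupling γ μ ν) {P : X → Prop} (hP : ∀ᵐ x ∂μ, P x) :
    ∀ᵐ p ∂γ, P p.1 := by
  rw [← h.1] at hP
  exact ae_of_ae_map measurable_fst.aemeasurable hP

theorem ae_snd (h : IsCoupling γ μ ν) {P : Y → Prop} (hP : ∀ᵐ y ∂ν, P y) :
    ∀ᵐ p ∂γ, P p.2 := by
  rw [← h.2] at hP
  exact ae_of_ae_map measurable_snd.aemeasurable hP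

theorem swap (h : IsCoupling γ μ ν) : IsCoupling (γ.map Prod.swap) ν μ := by
  constructor
  · rw [Measure.map_map measurable_fst measurable_swap]; exact h.2
  · rw [Measure.map_map measurable_snd measurable_swap]; exact h.1

theorem map {X' Y' : Type*} [MeasurableSpace X'] [MeasurableSpace Y'] (h : IsCoupling γ μ ν)
    {f : X → X'} {g : Y → Y'} (hf : Measurable f) (hg : Measurable g) :
    IsCoupling (γ.map (Prod.map f g)) (μ.map f) (ν.map g) := by
  constructor
  · rw [Measure.map_map measurable_fst (hf.prodMap hg), ← h.1,
      Measure.map_map hf measurable_fst]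
    rfl
  · rw [Measure.map_map measurable_snd (hf.prodMap hg), ← h.2,
      Measure.map_map hg measurable_snd]
    rfl

/-- The product coupling. -/
theorem prod (μ : Measure X) (ν : Measure Y) [IsProbabilityMeasure μ] [IsProbabilityMeasure ν] :
    IsCoupling (μ.prod ν) μ ν :=
  ⟨Measure.fst_prod, Measure.snd_prod⟩

/-- The gluing lemma: couplings with a common marginal are marginals of a single measure. -/
theorem exists_glue [StandardBorelSpace X] [StandardBorelSpace Z] [Nonempty X] [Nonempty Z]
    {γ' : Measure (Y × Z)} {ρ : Measure Z} [IsProbabilityMeasure μ] [IsProbabilityMeasure ν]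
    (h : IsCoupling γ μ ν) (h' : IsCoupling γ' ν ρ) :
    ∃ θ : Measure (Y × (X × Z)), θ.map (fun t => (t.2.1, t.1)) = γ ∧
      θ.map (fun t => (t.1, t.2.2)) = γ' := by
  have := h.isProbabilityMeasure
  have := h'.isProbabilityMeasure
  have := h.swap.isProbabilityMeasure
  -- Both couplings are disintegrated over the common marginal `ν`; given the middle point, the
  -- outer points are taken independent.
  let κ := (γ.map Prod.swap).condKernel
  let κ' := γ'.condKernel
  have hκ : ν.compProd κ = γ.map Prod.swap := by
    conv_lhs => rw [← h.swap.1]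
    exact (γ.map Prod.swap).disintegrate _
  have hκ' : ν.compProd κ' = γ' := by
    conv_lhs => rw [← h'.1]
    exact γ'.disintegrate _
  refine ⟨ν.compProd (κ.prod κ'), ?_, ?_⟩
  · have h1 : (ν.compProd (κ.prod κ')).map (Prod.map id Prod.fst) = ν.compProd κ := by
      rw [← Measure.compProd_map measurable_fst, ← ProbabilityTheory.Kernel.fst_eq,
        ProbabilityTheory.Kernel.fst_prod]
    rw [hκ] at h1
    have h2 : γ = (γ.map Prod.swap).map Prod.swap := by
      rw [Measure.map_map measurable_swap measurable_swap, Prod.swap_swap_eq, Measure.map_id]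
    rw [h2, ← h1, Measure.map_map measurable_swap (by fun_prop)]
    rfl
  · rw [← hκ']
    have h1 : (ν.compProd (κ.prod κ')).map (Prod.map id Prod.snd) = ν.compProd κ' := by
      rw [← Measure.compProd_map measurable_snd, ← ProbabilityTheory.Kernel.snd_eq,
        ProbabilityTheory.Kernel.snd_prod]
    exact h1

end IsCoupling

section Wasserstein

variable {E : Type v} [MetricSpace E] [MeasurableSpace E] {μ ν ρ : Measure E}

/-- A closed conull set contains the support. Conversely the support is conull under second
countability, as the next lemma uses, so suprema over supports can be handled as almost-everywhere
bounds. -/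
theorem wassersteinInf_le {γ : Measure (E × E)} (hγ : IsCoupling γ μ ν) {r : ℝ≥0∞}
    (h : ∀ᵐ p ∂γ, edist p.1 p.2 ≤ r) : wassersteinInf μ ν ≤ r := by
  refine iInf₂_le_of_le γ hγ (iSup₂_le fun p hp => ?_)
  have hC : IsClosed {p : E × E | edist p.1 p.2 ≤ r} :=
    isClosed_le (by fun_prop) continuous_const
  exact Measure.support_subset_of_isClosed hC h hp

variable [SecondCountableTopology E]

theorem exists_isCoupling_of_wassersteinInf_lt {r : ℝ≥0∞} (h : wassersteinInf μ ν < r) :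
    ∃ γ, IsCoupling γ μ ν ∧ ∀ᵐ p ∂γ, edist p.1 p.2 ≤ r := by
  obtain ⟨γ, hγ, hr⟩ := by simpa only [wassersteinInf, iInf_lt_iff] using h
  refine ⟨γ, hγ, ?_⟩
  filter_upwards [Measure.support_mem_ae (μ := γ)] with p hp
  exact (le_iSup₂ (f := fun (p : E × E) (_ : p ∈ γ.support) => edist p.1 p.2) p hp).trans hr.le

variable [BorelSpace E]

theorem wassersteinInf_comm (μ ν : Measure E) : wassersteinInf μ ν = wassersteinInf ν μ := by
  have key : ∀ μ ν : Measure E, wassersteinInf μ ν ≤ wassersteinInf ν μ := by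
    intro μ ν
    refine le_of_forall_gt fun r hr => ?_
    obtain ⟨r', hr', hr'r⟩ := exists_between hr
    obtain ⟨γ, hγ, h⟩ := exists_isCoupling_of_wassersteinInf_lt hr'
    refine (wassersteinInf_le hγ.swap (r := r') ?_).trans_lt hr'r
    rw [ae_map_iff measurable_swap.aemeasurable
      (measurableSet_le (measurable_fst.edist measurable_snd) measurable_const)]
    filter_upwards [h] with p hp
    rwa [Prod.fst_swap, Prod.snd_swap, edist_comm]
  exact le_antisymm (key μ ν) (key ν μ)

/-- Two pushforwards of a measure along uniformly close maps are close. -/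
theorem wassersteinInf_map_map_le {X : Type*} [MeasurableSpace X] {μ : Measure X} {f g : X → E}
    (hf : Measurable f) (hg : Measurable g) {r : ℝ≥0∞} (h : ∀ᵐ x ∂μ, edist (f x) (g x) ≤ r) :
    wassersteinInf (μ.map f) (μ.map g) ≤ r := by
  refine wassersteinInf_le (γ := μ.map fun x => (f x, g x)) ⟨?_, ?_⟩ ?_
  · rw [Measure.map_map measurable_fst (hf.prodMk hg)]; rfl
  · rw [Measure.map_map measurable_snd (hf.prodMk hg)]; rfl
  · rwa [ae_map_iff (hf.prodMk hg).aemeasurable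
      (measurableSet_le (measurable_fst.edist measurable_snd) measurable_const)]

theorem wassersteinInf_self (μ : Measure E) : wassersteinInf μ μ = 0 := by
  have := wassersteinInf_map_map_le (μ := μ) (f := id) (g := id) measurable_id measurable_id
    (r := 0) (by simp)
  rwa [Measure.map_id, nonpos_iff_eq_zero] at this

theorem wassersteinInf_map_le {f : E → E} (hf : Isometry f) :
    wassersteinInf (μ.map f) (ν.map f) ≤ wassersteinInf μ ν := by
  refine le_of_forall_gt fun r hr => ?_
  obtain ⟨r', hr', hr'r⟩ := exists_between hr
  obtain ⟨γ, hγ, h⟩ := exists_isCoupling_of_wassersteinInf_lt hr'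
  have hm := hf.continuous.measurable
  refine (wassersteinInf_le (hγ.map hm hm) (r := r') ?_).trans_lt hr'r
  rw [ae_map_iff (hm.prodMap hm).aemeasurable
    (measurableSet_le (measurable_fst.edist measurable_snd) measurable_const)]
  filter_upwards [h] with p hp
  rwa [Prod.map_fst, Prod.map_snd, hf.edist_eq]

/-- Couplings within `ε / 2` of optimal are glued along `ν`; the outer marginal of the glued measure
satisfies the sum of the two bounds. -/
theorem wassersteinInf_triangle [CompleteSpace E] [IsProbabilityMeasure μ]
    [IsProbabilityMeasure ν] :
    wassersteinInf μ ρ ≤ wassersteinInf μ ν + wassersteinInf ν ρ := by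
  have hE : Nonempty E := nonempty_of_isProbabilityMeasure μ
  refine ENNReal.le_of_forall_pos_le_add fun ε hε hfin => ?_
  have hε' : ((ε / 2 : NNReal) : ℝ≥0∞) ≠ 0 := by exact_mod_cast (half_pos hε).ne'
  obtain ⟨h1, h2⟩ := ENNReal.add_lt_top.1 hfin
  obtain ⟨γ, hγ, hr⟩ := exists_isCoupling_of_wassersteinInf_lt (ENNReal.lt_add_right h1.ne hε')
  obtain ⟨γ', hγ', hr'⟩ := exists_isCoupling_of_wassersteinInf_lt (ENNReal.lt_add_right h2.ne hε')
  obtain ⟨θ, hθ, hθ'⟩ := hγ.exists_glue hγ'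
  have m1 : Measurable fun t : E × (E × E) => (t.2.1, t.1) := by fun_prop
  have m2 : Measurable fun t : E × (E × E) => (t.1, t.2.2) := by fun_prop
  refine wassersteinInf_le (γ := θ.map Prod.snd) ⟨?_, ?_⟩ ?_
  · rw [Measure.map_map measurable_fst measurable_snd, ← hγ.1, ← hθ,
      Measure.map_map measurable_fst m1]
    rfl
  · rw [Measure.map_map measurable_snd measurable_snd, ← hγ'.2, ← hθ',
      Measure.map_map measurable_snd m2]
    rfl
  · rw [ae_map_iff measurable_snd.aemeasurable
      (measurableSet_le (measurable_fst.edist measurable_snd) measurable_const)]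
    rw [← hθ] at hr
    rw [← hθ'] at hr'
    filter_upwards [ae_of_ae_map m1.aemeasurable hr, ae_of_ae_map m2.aemeasurable hr']
      with t ht ht'
    refine (edist_triangle t.2.1 t.1 t.2.2).trans ((add_le_add ht ht').trans_eq ?_)
    rw [add_add_add_comm, ← ENNReal.coe_add, add_halves]

/-- A coupling that moves mass by at most `δ` sends `F` into its closed `δ`-thickening, and the
measures of these thickenings tend to that of `F`. -/
theorem measure_le_of_wassersteinInf_eq_zero [IsProbabilityMeasure ν]
    (h : wassersteinInf μ ν = 0) {F : Set E} (hF : IsClosed F) : μ F ≤ ν F := by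
  have hlim := tendsto_measure_cthickening_of_isClosed (μ := ν) (s := F)
    ⟨1, one_pos, measure_ne_top _ _⟩ hF
  refine ge_of_tendsto (hlim.mono_left (nhdsWithin_le_nhds (s := Set.Ioi 0))) ?_
  filter_upwards [self_mem_nhdsWithin] with δ hδ
  have hlt : wassersteinInf μ ν < ENNReal.ofReal δ := by
    rw [h]; exact ENNReal.ofReal_pos.2 hδ
  obtain ⟨γ, hγ, hr⟩ := exists_isCoupling_of_wassersteinInf_lt hlt
  rw [← hγ.1, ← hγ.2, Measure.map_apply measurable_fst hF.measurableSet,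
    Measure.map_apply measurable_snd Metric.isClosed_cthickening.measurableSet]
  refine measure_mono_ae ?_
  filter_upwards [hr] with p hp hpF
  refine Metric.mem_cthickening_of_edist_le p.2 p.1 δ F hpF ?_
  rwa [edist_comm]

/-- The closed sets form a π-system generating the Borel sets, and the preceding inequality holds in
both directions. -/
theorem eq_of_wassersteinInf_eq_zero [IsProbabilityMeasure μ] [IsProbabilityMeasure ν]
    (h : wassersteinInf μ ν = 0) : μ = ν := by
  refine ext_of_generate_finite _ ?_ isPiSystem_isClosed (fun F hF => ?_) (by simp)
  · rw [BorelSpace.measurable_eq (α := E), borel_eq_generateFrom_isClosed]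
  · exact le_antisymm (measure_le_of_wassersteinInf_eq_zero h hF)
      (measure_le_of_wassersteinInf_eq_zero ((wassersteinInf_comm ν μ).trans h) hF)

instance (μ : CompactLaw E) : IsProbabilityMeasure μ.law := μ.prob

theorem CompactLaw.wassersteinInf_ne_top (μ ν : CompactLaw E) :
    wassersteinInf μ.law ν.law ≠ ⊤ := by
  have hb := (μ.compact_support.union ν.compact_support).isBounded.ediam_ne_top
  refine ne_top_of_le_ne_top hb (wassersteinInf_le (IsCoupling.prod μ.law ν.law) ?_)
  filter_upwards [(IsCoupling.prod μ.law ν.law).ae_fst (Measure.support_mem_ae (μ := μ.law)),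
    (IsCoupling.prod μ.law ν.law).ae_snd (Measure.support_mem_ae (μ := ν.law))] with p h1 h2
  exact Metric.edist_le_ediam_of_mem (.inl h1) (.inr h2)

/-- The `∞`-Wasserstein metric on compactly supported laws. -/
@[reducible]
noncomputable def CompactLaw.wassersteinMetric [CompleteSpace E] : MetricSpace (CompactLaw E) :=
  letI : EMetricSpace (CompactLaw E) :=
    { edist := fun μ ν => wassersteinInf μ.law ν.law
      edist_self := fun μ => wassersteinInf_self μ.law
      edist_comm := fun μ ν => wassersteinInf_comm μ.law ν.law
      edist_triangle := fun _ _ _ => wassersteinInf_triangle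
      eq_of_edist_eq_zero := fun {_ _} h => CompactLaw.ext (eq_of_wassersteinInf_eq_zero h) }
  EMetricSpace.toMetricSpace CompactLaw.wassersteinInf_ne_top

/-- Every point of the support of the second measure is close to the support of the first. -/
theorem exists_mem_support_edist_le {r : ℝ≥0∞} [IsProbabilityMeasure μ]
    (hμ : IsCompact μ.support) (h : wassersteinInf μ ν < r) {y : E} (hy : y ∈ ν.support) :
    ∃ x ∈ μ.support, edist y x ≤ r := by
  obtain ⟨γ, hγ, hr⟩ := exists_isCoupling_of_wassersteinInf_lt h
  have hne : μ.support.Nonempty := Measure.nonempty_support (IsProbabilityMeasure.ne_zero μ)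
  -- This closed condition passes from almost every point to every point of the support of `ν`;
  -- compactness then supplies a nearest point.
  have hC : IsClosed {y | Metric.infEDist y μ.support ≤ r} :=
    isClosed_le Metric.continuous_infEDist continuous_const
  have hae : ∀ᵐ y ∂ν, Metric.infEDist y μ.support ≤ r := by
    rw [← hγ.2, ae_map_iff measurable_snd.aemeasurable hC.measurableSet]
    filter_upwards [hr, hγ.ae_fst (Measure.support_mem_ae (μ := μ))] with p hp hp'
    exact (Metric.infEDist_le_edist_of_mem hp').trans (by rwa [edist_comm])
  obtain ⟨x, hx, hxy⟩ := hμ.exists_infEDist_eq_edist hne y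
  exact ⟨x, hx, hxy ▸ Measure.support_subset_of_isClosed hC hae hy⟩

end Wasserstein

/-! ### The action on laws and closedness of its orbits -/

namespace BField

variable {B : Type u} [MetricSpace B] {U : BField.{u, v} B}

@[simp]
theorem smul_law (g : U.Aut) (μ : CompactLaw U) : (g • μ).law = μ.law.map g.1 := rfl

/-- Automorphisms act isometrically for the `∞`-Wasserstein distance. -/
theorem wassersteinInf_smul (g : U.Aut) (μ ν : CompactLaw U) :
    wassersteinInf (g • μ).law (g • ν).law = wassersteinInf μ.law ν.law := by
  refine le_antisymm (wassersteinInf_map_le g.1.isometry) ?_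
  have := wassersteinInf_map_le (μ := (g • μ).law) (ν := (g • ν).law) (g⁻¹).1.isometry
  rwa [← smul_law, ← smul_law, inv_smul_smul, inv_smul_smul] at this

/-- The orbits of the automorphism group of a Urysohn field on compactly supported laws are
closed. -/
theorem IsUrysohn.exists_smul_eq_of_iInf_eq_zero (hU : U.IsUrysohn) {μ ν : CompactLaw U}
    (h : ⨅ g : U.Aut, wassersteinInf μ.law (g • ν).law = 0) : ∃ g : U.Aut, g • ν = μ := by
  have hseq : ∀ n : ℕ, ∃ g : U.Aut,
      wassersteinInf μ.law (g • ν).law < ENNReal.ofReal (1 / (n + 1 : ℝ)) := fun n => by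
    rw [← iInf_lt_iff, h]
    exact ENNReal.ofReal_pos.2 Nat.one_div_pos_of_nat
  choose g hg using hseq
  -- A nonprincipal ultrafilter gives limits of `g n x` for all `x` in the support at once, without
  -- a diagonal subsequence. They exist since `g n x` is within `1 / (n + 1)` of the compact support
  -- of `μ`.
  let F : Ultrafilter ℕ := Filter.hyperfilter ℕ
  have hF0 : Filter.Tendsto (fun n : ℕ => 1 / (n + 1 : ℝ)) F (nhds 0) :=
    tendsto_one_div_add_atTop_nhds_zero_nat.mono_left Nat.hyperfilter_le_atTop
  have hlim : ∀ x : ν.law.support, ∃ y, Filter.Tendsto (fun n => (g n).1 x.1) F (nhds y) := by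
    intro x
    have hnear : ∀ n, ∃ l ∈ μ.law.support, dist l ((g n).1 x.1) ≤ 1 / (n + 1 : ℝ) := by
      intro n
      have hC : IsClosed ((g n).1 ⁻¹' (g n • ν).law.support) :=
        Measure.isClosed_support.preimage (g n).1.continuous
      have hx := Measure.support_subset_of_isClosed hC
        (ae_of_ae_map (g n).1.continuous.measurable.aemeasurable
          (Measure.support_mem_ae (μ := (g n • ν).law))) x.2
      obtain ⟨l, hl, hlx⟩ := exists_mem_support_edist_le μ.compact_support (hg n) hx
      refine ⟨l, hl, ?_⟩
      rwa [edist_dist, ENNReal.ofReal_le_ofReal_iff Nat.one_div_pos_of_nat.le, dist_comm] at hlx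
    choose l hl hlx using hnear
    obtain ⟨y, -, hy⟩ := μ.compact_support.ultrafilter_le_nhds (F.map l)
      (Filter.le_principal_iff.2 (Filter.mem_map.2 (Filter.univ_mem' hl)))
    have hy' : Filter.Tendsto l F (nhds y) := hy
    exact ⟨y, hy'.congr_dist (squeeze_zero (fun _ => dist_nonneg) hlx hF0)⟩
  choose f hf using hlim
  have hfi : Isometry f := Isometry.of_dist_eq fun x y => by
    refine tendsto_nhds_unique ((hf x).dist (hf y)) ?_
    simp only [(g _).1.dist_eq]
    exact tendsto_const_nhds
  have hcs : CompactSpace ν.law.support := isCompact_iff_compactSpace.1 ν.compact_support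
  obtain ⟨k, hk⟩ := hU.exists_aut_of_isPartialIso
    (R := Set.range fun x : ν.law.support => (x.1, f x))
    (isCompact_range (continuous_subtype_val.prodMk hfi.continuous)) (by
      constructor
      · rintro _ ⟨x, rfl⟩ _ ⟨y, rfl⟩
        exact (hfi.dist_eq x y).symm
      · rintro _ ⟨x, rfl⟩
        refine tendsto_nhds_unique ?_ ((U.lipschitz.continuous.tendsto _).comp (hf x))
        exact tendsto_const_nhds.congr fun n => ((g n).2 x).symm)
  refine ⟨k, (CompactLaw.ext (eq_of_wassersteinInf_eq_zero ?_)).symm⟩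
  -- One `ε` comes from `g n • ν` being close to `μ`. The other three compare `g n` with `k` on the
  -- support of `ν`: one at a point of a finite `ε`-net, and one on each side to reach that point.
  have hsmall : ∀ ε : NNReal, 0 < ε → wassersteinInf μ.law (k • ν).law ≤ 4 * (ε : ℝ≥0∞) := by
    intro ε hε
    obtain ⟨t, ht, htf, htc⟩ := ν.compact_support.finite_cover_balls (e := (ε : ℝ)) hε
    have hev : ∀ᶠ n in (F : Filter ℕ), ∀ x ∈ t, dist ((g n).1 x) (k.1 x) < ε := by
      refine (Filter.eventually_all_finite htf).2 fun x hx => ?_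
      rw [hk (x, f ⟨x, ht hx⟩) ⟨⟨x, ht hx⟩, rfl⟩]
      exact (tendsto_iff_dist_tendsto_zero.1 (hf ⟨x, ht hx⟩)).eventually (gt_mem_nhds hε)
    obtain ⟨n, hn, hnε⟩ := (hev.and (hF0.eventually (gt_mem_nhds (NNReal.coe_pos.2 hε)))).exists
    have h1 : wassersteinInf μ.law (g n • ν).law ≤ ε := by
      refine (hg n).le.trans ?_
      rw [ENNReal.ofReal_le_iff_le_toReal ENNReal.coe_ne_top]
      exact hnε.le
    have h2 : wassersteinInf (g n • ν).law (k • ν).law ≤ 3 * (ε : ℝ≥0∞) := by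
      refine wassersteinInf_map_map_le (g n).1.continuous.measurable k.1.continuous.measurable ?_
      filter_upwards [Measure.support_mem_ae (μ := ν.law)] with x hx
      obtain ⟨c, hc, hxc⟩ := Set.mem_iUnion₂.1 (htc hx)
      have h3 := dist_triangle4 ((g n).1 x) ((g n).1 c) (k.1 c) (k.1 x)
      rw [(g n).1.dist_eq, k.1.dist_eq, dist_comm c x] at h3
      have h4 := hn c hc
      rw [Metric.mem_ball] at hxc
      have h5 : (3 * (ε : ℝ≥0∞)) = ENNReal.ofReal (3 * (ε : ℝ)) := by
        rw [ENNReal.ofReal_mul (by norm_num)]; simp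
      rw [h5, edist_dist]
      exact ENNReal.ofReal_le_ofReal (by linarith)
    calc wassersteinInf μ.law (k • ν).law
        ≤ _ := wassersteinInf_triangle (ν := (g n • ν).law)
      _ ≤ ε + 3 * (ε : ℝ≥0∞) := add_le_add h1 h2
      _ = 4 * (ε : ℝ≥0∞) := by ring
  refine nonpos_iff_eq_zero.1 (ENNReal.le_of_forall_pos_le_add fun ε hε _ => ?_)
  refine (hsmall (ε / 4) (by positivity)).trans_eq ?_
  rw [zero_add, ← ENNReal.coe_ofNat, ← ENNReal.coe_mul, mul_div_cancel₀ _ (by norm_num)]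

end BField

/-! ### Quotients of metric spaces by isometric actions -/

section OrbitDistance

variable {G : Type w} {α : Type v} [Group G] [PseudoEMetricSpace α] [MulAction G α]
  [IsIsometricSMul G α]

/-- The distance between orbits of an isometric action. -/
noncomputable def orbitEDist (a b : Quotient (MulAction.orbitRel G α)) : ℝ≥0∞ :=
  Quotient.liftOn₂ a b (fun x y => ⨅ g : G, edist x (g • y)) (by
    rintro _ _ x y ⟨h, rfl⟩ ⟨k, rfl⟩
    refine Equiv.iInf_congr ((Equiv.mulLeft h⁻¹).trans (Equiv.mulRight k)) fun g => ?_
    simp only [Equiv.trans_apply, Equiv.coe_mulLeft, Equiv.coe_mulRight]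
    rw [mul_smul, mul_smul, ← edist_smul_left h x, smul_inv_smul])

theorem orbitEDist_mk (x y : α) :
    orbitEDist (Quotient.mk (MulAction.orbitRel G α) x) (Quotient.mk _ y) =
      ⨅ g : G, edist x (g • y) := rfl

/-- The orbit distance of an isometric action is a pseudometric. -/
@[reducible]
noncomputable def orbitPseudoEMetric : PseudoEMetricSpace (Quotient (MulAction.orbitRel G α)) where
  edist := orbitEDist
  edist_self a := by
    induction a using Quotient.inductionOn with | _ x
    rw [orbitEDist_mk]
    exact nonpos_iff_eq_zero.1 (iInf_le_of_le 1 (by simp))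
  edist_comm a b := by
    induction a, b using Quotient.inductionOn₂ with | _ x y
    rw [orbitEDist_mk, orbitEDist_mk]
    refine Equiv.iInf_congr (Equiv.inv G) fun g => ?_
    rw [Equiv.inv_apply, ← edist_smul_left g y, smul_inv_smul, edist_comm]
  edist_triangle a b c := by
    induction a, b using Quotient.inductionOn₂ with | _ x y
    induction c using Quotient.inductionOn with | _ z
    rw [orbitEDist_mk, orbitEDist_mk, orbitEDist_mk, ENNReal.iInf_add]
    refine le_iInf fun g => ?_
    rw [ENNReal.add_iInf]
    refine le_iInf fun h => iInf_le_of_le (g * h) ?_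
    rw [← edist_smul_left g y, mul_smul]
    exact edist_triangle _ _ _

/-- An admissible pseudometric cannot tell `y` from `g • y`, so it is bounded by every `edist x (g •
y)`. The orbit distance is itself admissible, by taking `g = 1`. -/
theorem quotientEDist_orbitRel (a b : Quotient (MulAction.orbitRel G α)) :
    quotientEDist (MulAction.orbitRel G α) (fun x y : α => edist x y) a b = orbitEDist a b := by
  refine le_antisymm (iSup₂_le fun p hp => ?_) ?_
  · induction a, b using Quotient.inductionOn₂ with | _ x y
    refine le_iInf fun g => ?_
    have : Quotient.mk (MulAction.orbitRel G α) y = Quotient.mk _ (g • y) :=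
      Quotient.sound (MulAction.orbitRel_apply.2 ⟨g⁻¹, inv_smul_smul g y⟩)
    rw [this]
    exact hp _ _
  · refine le_iSup₂_of_le orbitPseudoEMetric (fun x y => ?_) le_rfl
    exact iInf_le_of_le (1 : G) (by rw [one_smul])

end OrbitDistance

/-! ### Laws pushed forward along isometric embeddings -/

section Pushforward

theorem Isometry.measurableEmbedding_of_complete {X Y : Type*} [MetricSpace X]
    [CompleteSpace X] [MeasurableSpace X] [BorelSpace X] [MetricSpace Y] [MeasurableSpace Y] [BorelSpace Y]
    {f : X → Y} (hf : Isometry f) : MeasurableEmbedding f :=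
  hf.isClosedEmbedding.measurableEmbedding

theorem MeasurableEmbedding.map_comap_of_ae {X Y : Type*} [MeasurableSpace X] [MeasurableSpace Y]
    {f : X → Y} (hf : MeasurableEmbedding f) {μ : Measure Y} (h : ∀ᵐ y ∂μ, y ∈ Set.range f) :
    (μ.comap f).map f = μ := by
  rw [hf.map_comap, Measure.restrict_eq_self_of_ae_mem h]

theorem support_map_of_isClosedEmbedding {X Y : Type*} [TopologicalSpace X]
    [HereditarilyLindelofSpace X] [MeasurableSpace X] [BorelSpace X] [TopologicalSpace Y]
    [HereditarilyLindelofSpace Y] [MeasurableSpace Y] [BorelSpace Y] {f : X → Y}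
    (hf : Topology.IsClosedEmbedding f) (μ : Measure X) :
    (μ.map f).support = f '' μ.support := by
  have hm := hf.continuous.measurable
  have hC := hf.isClosedMap _ (Measure.isClosed_support (μ := μ))
  refine (Measure.support_subset_of_isClosed hC ?_).antisymm (Set.image_subset_iff.2 ?_)
  · refine (ae_map_iff (p := (· ∈ f '' μ.support)) hm.aemeasurable hC.measurableSet).2 ?_
    filter_upwards [Measure.support_mem_ae (μ := μ)] with x hx using ⟨x, hx, rfl⟩
  · exact Measure.support_subset_of_isClosed
      (Measure.isClosed_support.preimage hf.continuous)
      (ae_of_ae_map hm.aemeasurable (Measure.support_mem_ae (μ := μ.map f)))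

end Pushforward

namespace BField

variable {B : Type u} [MetricSpace B]

theorem IsEmbedding.aut_comp {X : BField.{u, w} B} {U : BField.{u, v} B} {ι : X → U}
    (hι : X.IsEmbedding U ι) (g : U.Aut) : X.IsEmbedding U (g.1 ∘ ι) where
  isometry := g.1.isometry.comp hι.isometry
  proj_comp x := (g.2 (ι x)).trans (hι.proj_comp x)

end BField

/-! ### Comparison of the Gromov-Wasserstein and Wasserstein distances -/

namespace MMField

variable {B : Type u} [MetricSpace B] {U : BField.{u, v} B}

instance (X : MMField.{u, v} B) : IsProbabilityMeasure X.law := X.prob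

/-- The Gromov-Wasserstein distance is at most the Wasserstein distance of the laws pushed
forward along embeddings into a common field. -/
theorem gromovWassersteinInf_le {X Y : MMField.{u, w} B} {ι : X.toBField → U} {κ : Y.toBField → U}
    (hι : X.toBField.IsEmbedding U ι) (hκ : Y.toBField.IsEmbedding U κ) :
    X.gromovWassersteinInf Y ≤ wassersteinInf (X.law.map ι) (Y.law.map κ) := by
  refine le_of_forall_gt fun s hs => ?_
  obtain ⟨r, hr, hrs⟩ := exists_between hs
  refine lt_of_le_of_lt ?_ hrs
  obtain ⟨γ, hγ, hd⟩ := exists_isCoupling_of_wassersteinInf_lt hr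
  have mι := hι.isometry.measurableEmbedding_of_complete
  have mκ := hκ.isometry.measurableEmbedding_of_complete
  have hj : MeasurableEmbedding (Prod.map ι κ) :=
    (hι.isometry.prodMap hκ.isometry).measurableEmbedding_of_complete
  -- The marginals of `γ` live on the embedded copies, hence `γ` lives on their product and is the
  -- pushforward of its pullback `δ`.
  have hrange : ∀ᵐ p ∂γ, p ∈ Set.range (Prod.map ι κ) := by
    have h1 : ∀ᵐ x ∂X.law.map ι, x ∈ Set.range ι := by
      refine (ae_map_iff (p := (· ∈ Set.range ι)) mι.measurable.aemeasurable
        mι.measurableSet_range).2 ?_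
      simp
    have h2 : ∀ᵐ x ∂Y.law.map κ, x ∈ Set.range κ := by
      refine (ae_map_iff (p := (· ∈ Set.range κ)) mκ.measurable.aemeasurable
        mκ.measurableSet_range).2 ?_
      simp
    filter_upwards [hγ.ae_fst h1, hγ.ae_snd h2] with p hp hp'
    rw [Set.range_prodMap]
    exact ⟨hp, hp'⟩
  set δ := γ.comap (Prod.map ι κ) with hδ
  have hδγ : δ.map (Prod.map ι κ) = γ := hj.map_comap_of_ae hrange
  have hcoup : IsCoupling δ X.law Y.law := by
    constructor
    · apply mι.map_injective
      rw [← hγ.1, ← hδγ, Measure.map_map mι.measurable measurable_fst,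
        Measure.map_map measurable_fst hj.measurable]
      rfl
    · apply mκ.map_injective
      rw [← hγ.2, ← hδγ, Measure.map_map mκ.measurable measurable_snd,
        Measure.map_map measurable_snd hj.measurable]
      rfl
  have hclosed : IsClosed {p : X.toBField × Y.toBField | edist (ι p.1) (κ p.2) ≤ r} :=
    isClosed_le ((hι.isometry.continuous.comp continuous_fst).edist
      (hκ.isometry.continuous.comp continuous_snd)) continuous_const
  have hsupp : ∀ p ∈ δ.support, edist (ι p.1) (κ p.2) ≤ r := by
    refine Measure.support_subset_of_isClosed hclosed ?_
    rw [← hδγ] at hd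
    exact ae_of_ae_map hj.measurable.aemeasurable hd
  refine iInf₂_le_of_le δ hcoup (max_le ?_ (iSup₂_le fun p hp => ?_))
  -- Each of the two matched pairs contributes `r` to the distortion; the factor `2⁻¹` absorbs the
  -- resulting `2`.
  · have h2 : (⨆ p ∈ δ.support, ⨆ q ∈ δ.support,
        ENNReal.ofReal |dist p.1 q.1 - dist p.2 q.2|) ≤ 2 * r := by
      refine iSup₂_le fun p hp => iSup₂_le fun q hq => ?_
      rw [← hι.isometry.dist_eq, ← hκ.isometry.dist_eq, ← Real.dist_eq, two_mul]
      refine (ENNReal.ofReal_le_ofReal (dist_dist_dist_le _ _ _ _)).trans ?_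
      rw [ENNReal.ofReal_add dist_nonneg dist_nonneg, ← edist_dist, ← edist_dist]
      exact add_le_add (hsupp p hp) (hsupp q hq)
    refine (mul_le_mul_right h2 _).trans_eq ?_
    rw [← mul_assoc, ENNReal.inv_mul_cancel (by norm_num) (by norm_num), one_mul]
  · rw [← hι.proj_comp, ← hκ.proj_comp]
    exact (U.lipschitz.edist_le_mul _ _).trans (by simpa using hsupp p hp)

/-- Compact `mm`-fields embed into a Urysohn field so that their laws are almost as close as their
Gromov-Wasserstein distance. -/
theorem exists_isEmbedding_wassersteinInf_le (hU : U.IsUrysohn) {X Y : MMField.{u, w} B}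
    [CompactSpace X.toBField] [CompactSpace Y.toBField] {r : ℝ≥0∞}
    (hr : X.gromovWassersteinInf Y < r) :
    ∃ (ι : X.toBField → U) (κ : Y.toBField → U), X.toBField.IsEmbedding U ι ∧
      Y.toBField.IsEmbedding U κ ∧ wassersteinInf (X.law.map ι) (Y.law.map κ) ≤ r := by
  rcases eq_or_ne r ⊤ with rfl | hr'
  · obtain ⟨ι, hι⟩ := hU.exists_isEmbedding X.toBField
    obtain ⟨κ, hκ⟩ := hU.exists_isEmbedding Y.toBField
    exact ⟨ι, κ, hι, hκ, le_top⟩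
  obtain ⟨γ, hγ, hlt⟩ := by simpa only [gromovWassersteinInf, iInf_lt_iff] using hr
  obtain ⟨hlt1, hlt2⟩ := max_lt_iff.1 hlt
  have := hγ.isProbabilityMeasure
  have hε : 0 < r.toReal := ENNReal.toReal_pos (bot_le.trans_lt hr).ne' hr'
  have hne : Nonempty γ.support :=
    (Measure.nonempty_support (IsProbabilityMeasure.ne_zero γ)).to_subtype
  let Φ : γ.support → X.toBField := fun p => p.1.1
  let Ψ : γ.support → Y.toBField := fun p => p.1.2
  have hdist : ∀ p q : γ.support, |dist (Φ p) (Φ q) - dist (Ψ p) (Ψ q)| ≤ 2 * r.toReal := by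
    intro p q
    have h1 : ENNReal.ofReal |dist (Φ p) (Φ q) - dist (Ψ p) (Ψ q)| ≤
        ⨆ p ∈ γ.support, ⨆ q ∈ γ.support, ENNReal.ofReal |dist p.1 q.1 - dist p.2 q.2| :=
      le_iSup₂_of_le p.1 p.2 (le_iSup₂_of_le q.1 q.2 le_rfl)
    have h2 := (mul_le_mul_right h1 2⁻¹).trans hlt1.le
    rw [ENNReal.inv_mul_le_iff (by norm_num) (by norm_num)] at h2
    rw [ENNReal.ofReal_le_iff_le_toReal (by finiteness), ENNReal.toReal_mul] at h2
    simpa using h2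
  have hproj : ∀ p : γ.support,
      dist (X.toBField.proj (Φ p)) (Y.toBField.proj (Ψ p)) ≤ r.toReal := by
    intro p
    rw [dist_edist]
    refine ENNReal.toReal_mono hr' (le_trans ?_ hlt2.le)
    exact le_iSup₂ (f := fun (p : X.toBField × Y.toBField) (_ : p ∈ γ.support) =>
      edist (X.toBField.proj p.1) (Y.toBField.proj p.2)) p.1 p.2
  -- The cross distance is the infimum over `p` of `dist x (Φ p) + dist y (Ψ p)`, plus `r`. The
  -- distortion bound `2r` yields the triangle inequality, and the base displacement bound `r` keeps
  -- the joint projection `1`-Lipschitz (`hcross`).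
  let m := Metric.glueMetricApprox Φ Ψ r.toReal hε hdist
  have hcross : ∀ x y, dist (X.toBField.proj x) (Y.toBField.proj y) ≤
      Metric.glueDist Φ Ψ r.toReal (.inl x) (.inr y) := by
    intro x y
    rw [Metric.glueDist, ← sub_le_iff_le_add]
    refine le_ciInf fun p => ?_
    have h1 := X.toBField.lipschitz.dist_le_mul x (Φ p)
    have h2 := Y.toBField.lipschitz.dist_le_mul y (Ψ p)
    have h3 := dist_triangle4 (X.toBField.proj x) (X.toBField.proj (Φ p))
      (Y.toBField.proj (Ψ p)) (Y.toBField.proj y)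
    rw [dist_comm (Y.toBField.proj (Ψ p))] at h3
    rw [NNReal.coe_one, one_mul] at h1 h2
    linarith [hproj p]
  -- The glued metric induces the topology of the disjoint sum, so the glued space is compact, hence
  -- complete and separable.
  have hcompact : @CompactSpace (X.toBField ⊕ Y.toBField)
      m.toPseudoMetricSpace.toUniformSpace.toTopologicalSpace :=
    inferInstanceAs (CompactSpace (X.toBField ⊕ Y.toBField))
  let Z : BField.{u, w} B :=
    { carrier := X.toBField ⊕ Y.toBField
      metric := m
      complete := inferInstance
      separable := inferInstance
      proj := Sum.elim X.toBField.proj Y.toBField.proj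
      lipschitz := by
        refine LipschitzWith.of_dist_le_mul ?_
        rw [NNReal.coe_one]
        rintro (x | y) (x' | y') <;> rw [one_mul]
        · exact (X.toBField.lipschitz.dist_le_mul x x').trans_eq (one_mul _)
        · exact hcross x y'
        · rw [dist_comm]; exact (hcross x' y).trans_eq (m.dist_comm _ _)
        · exact (Y.toBField.lipschitz.dist_le_mul y y').trans_eq (one_mul _) }
  obtain ⟨j, hj⟩ := hU.exists_isEmbedding Z
  have hinl : X.toBField.IsEmbedding Z (Sum.inl : _ → X.toBField ⊕ Y.toBField) :=
    ⟨Isometry.of_dist_eq fun _ _ => rfl, fun _ => rfl⟩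
  have hinr : Y.toBField.IsEmbedding Z (Sum.inr : _ → X.toBField ⊕ Y.toBField) :=
    ⟨Isometry.of_dist_eq fun _ _ => rfl, fun _ => rfl⟩
  have hι : X.toBField.IsEmbedding U fun x => j (Sum.inl x : X.toBField ⊕ Y.toBField) :=
    ⟨hj.isometry.comp hinl.isometry, fun x => hj.proj_comp _⟩
  have hκ : Y.toBField.IsEmbedding U fun y => j (Sum.inr y : X.toBField ⊕ Y.toBField) :=
    ⟨hj.isometry.comp hinr.isometry, fun x => hj.proj_comp _⟩
  refine ⟨_, _, hι, hκ, ?_⟩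
  have mι := hι.isometry.continuous.measurable
  have mκ := hκ.isometry.continuous.measurable
  refine wassersteinInf_le (hγ.map mι mκ) ?_
  rw [ae_map_iff (mι.prodMap mκ).aemeasurable
    (measurableSet_le (measurable_fst.edist measurable_snd) measurable_const)]
  filter_upwards [Measure.support_mem_ae (μ := γ)] with p hp
  rw [Prod.map_fst, Prod.map_snd, hj.isometry.edist_eq, edist_dist,
    ENNReal.ofReal_le_iff_le_toReal hr']
  exact (Metric.glueDist_glued_points Φ Ψ r.toReal ⟨p, hp⟩).le

end MMField

namespace CompactMMField

variable {B : Type u} [MetricSpace B] {U : BField.{u, v} B}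

instance (X : CompactMMField.{u, w} B) : CompactSpace X.toBField := X.compact

/-- The law of a compact `mm`-field, pushed forward along an embedding. -/
noncomputable abbrev pushLaw (X : CompactMMField.{u, w} B) {ι : X.toBField → U}
    (hι : X.toBField.IsEmbedding U ι) : CompactLaw U :=
  X.compactLaw.map ι hι.isometry.continuous

theorem smul_pushLaw (X : CompactMMField.{u, w} B) {ι : X.toBField → U}
    (hι : X.toBField.IsEmbedding U ι) (g : U.Aut) :
    g • X.pushLaw hι = X.pushLaw (hι.aut_comp g) :=
  CompactLaw.ext (Measure.map_map g.1.continuous.measurable hι.isometry.continuous.measurable)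

/-- In a Urysohn field, all embeddings of a compact `mm`-field push its law to the same orbit. -/
theorem exists_smul_pushLaw_eq (hU : U.IsUrysohn) (X : CompactMMField.{u, w} B)
    {ι κ : X.toBField → U} (hι : X.toBField.IsEmbedding U ι) (hκ : X.toBField.IsEmbedding U κ) :
    ∃ g : U.Aut, g • X.pushLaw hι = X.pushLaw hκ := by
  obtain ⟨g, hg⟩ := hU.exists_aut_comp_eq hι hκ
  obtain rfl : g.1 ∘ ι = κ := funext hg
  exact ⟨g, X.smul_pushLaw hι g⟩

theorem mk_pushLaw_eq (hU : U.IsUrysohn) (X : CompactMMField.{u, w} B)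
    {ι κ : X.toBField → U} (hι : X.toBField.IsEmbedding U ι) (hκ : X.toBField.IsEmbedding U κ) :
    LawOrbits.mk (X.pushLaw hι) = LawOrbits.mk (X.pushLaw hκ) :=
  Quotient.sound (MulAction.orbitRel_apply.2 (X.exists_smul_pushLaw_eq hU hκ hι))

/-- A translate of `κ` is again an embedding, so each term bounds the right side from above.
Conversely, homogeneity carries `ι` and `κ` to a near-optimal pair by automorphisms `g` and `h`, and
invariance reduces these to the single automorphism `g⁻¹ * h`. -/
theorem iInf_wassersteinInf_eq (hU : U.IsUrysohn) (X Y : CompactMMField.{u, w} B)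
    {ι : X.toBField → U} {κ : Y.toBField → U} (hι : X.toBField.IsEmbedding U ι)
    (hκ : Y.toBField.IsEmbedding U κ) :
    ⨅ g : U.Aut, wassersteinInf (X.pushLaw hι).law (g • Y.pushLaw hκ).law =
      X.toMMField.gromovWassersteinInf Y.toMMField := by
  refine le_antisymm (le_of_forall_gt fun s hs => ?_) (le_iInf fun g => ?_)
  · obtain ⟨r, hr, hrs⟩ := exists_between hs
    obtain ⟨ι', κ', hι', hκ', hle⟩ := MMField.exists_isEmbedding_wassersteinInf_le hU hr
    obtain ⟨g, hg⟩ := X.exists_smul_pushLaw_eq hU hι hι'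
    obtain ⟨h, hh⟩ := Y.exists_smul_pushLaw_eq hU hκ hκ'
    refine lt_of_le_of_lt (iInf_le_of_le (g⁻¹ * h) ?_) hrs
    rw [← BField.wassersteinInf_smul g, mul_smul, smul_inv_smul, hg, hh]
    exact hle
  · rw [smul_pushLaw]
    exact MMField.gromovWassersteinInf_le hι (hκ.aut_comp g)

/-- Fully supported compact `mm`-fields whose laws have the same orbit are isomorphic. -/
theorem iso_of_mk_pushLaw_eq {X Y : CompactMMField.{u, w} B} (hX : X.FullySupported)
    (hY : Y.FullySupported) {ι : X.toBField → U} {κ : Y.toBField → U}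
    (hι : X.toBField.IsEmbedding U ι) (hκ : Y.toBField.IsEmbedding U κ)
    (h : LawOrbits.mk (X.pushLaw hι) = LawOrbits.mk (Y.pushLaw hκ)) :
    X.toMMField.Iso Y.toMMField := by
  obtain ⟨g, hg⟩ := MulAction.orbitRel_apply.1 (Quotient.exact h)
  replace hg : g • Y.pushLaw hκ = X.pushLaw hι := hg
  rw [smul_pushLaw] at hg
  replace hκ := hκ.aut_comp g
  set κ' := g.1 ∘ κ
  have hlaw : Y.law.map κ' = X.law.map ι := congrArg CompactLaw.law hg
  -- Full support enters here: both ranges are the support of the same law, so `κ'⁻¹ ∘ ι` is defined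
  -- on all of `X` and onto `Y`.
  have hrange : Set.range κ' = Set.range ι := by
    have := congrArg Measure.support hlaw
    rwa [support_map_of_isClosedEmbedding hκ.isometry.isClosedEmbedding,
      support_map_of_isClosedEmbedding hι.isometry.isClosedEmbedding, hX, hY, Set.image_univ,
      Set.image_univ] at this
  have h1 : ∀ x, ∃ y, κ' y = ι x := fun x => hrange.ge ⟨x, rfl⟩
  have h2 : ∀ y, ∃ x, ι x = κ' y := fun y => hrange.le ⟨y, rfl⟩
  choose f hf using h1
  choose f' hf' using h2
  have hfi : Isometry f := fun x x' => by
    rw [← hκ.isometry.edist_eq, hf, hf, hι.isometry.edist_eq]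
  refine ⟨IsometryEquiv.mk' f f' (fun y => hκ.isometry.injective ?_) hfi, fun x => ?_, ?_⟩
  · rw [hf, hf']
  · exact ((hκ.proj_comp _).symm.trans (congrArg U.proj (hf x))).trans (hι.proj_comp x)
  · apply hκ.isometry.measurableEmbedding_of_complete.map_injective
    rw [hlaw, Measure.map_map hκ.isometry.continuous.measurable
      (IsometryEquiv.continuous _).measurable]
    congr 1
    exact funext hf

/-- Isomorphic compact `mm`-fields push their laws to the same orbit of a Urysohn field. -/
theorem mk_pushLaw_eq_of_iso (hU : U.IsUrysohn) {X Y : CompactMMField.{u, w} B}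
    (h : X.toMMField.Iso Y.toMMField) {ι : X.toBField → U} {κ : Y.toBField → U}
    (hι : X.toBField.IsEmbedding U ι) (hκ : Y.toBField.IsEmbedding U κ) :
    LawOrbits.mk (X.pushLaw hι) = LawOrbits.mk (Y.pushLaw hκ) := by
  obtain ⟨e, he, hm⟩ := h
  have hκe : X.toBField.IsEmbedding U (κ ∘ e) :=
    ⟨hκ.isometry.comp e.isometry, fun x => (hκ.proj_comp _).trans (he x)⟩
  have : X.pushLaw hκe = Y.pushLaw hκ := by
    refine CompactLaw.ext ?_
    change X.law.map (κ ∘ e) = Y.law.map κ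
    rw [← Measure.map_map hκ.isometry.continuous.measurable e.continuous.measurable]
    exact congrArg _ hm
  rw [X.mk_pushLaw_eq hU hι hκe, this]

end CompactMMField

/-! ### Realization of laws by fields and the resulting bijection -/

/-- A compact subset of a metric space has an isometric copy in every universe. -/
theorem IsCompact.exists_isometry_range_eq {E : Type v} [MetricSpace E] {K : Set E}
    (hK : IsCompact K) : ∃ (T : Type w) (_ : MetricSpace T) (_ : CompactSpace T) (j : T → E),
      Isometry j ∧ Set.range j = K := by
  have := isCompact_iff_compactSpace.1 hK
  -- The Kuratowski image lies in a space of bounded sequences in the lowest universe, from which it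
  -- can be lifted to any universe; `K` itself could not be moved directly.
  let e := (kuratowskiEmbedding.isometry K).isometryEquivOnRange
  let i : ULift.{w} (Set.range (kuratowskiEmbedding K)) → K := fun t => e.symm t.down
  have hi : Isometry i := e.symm.isometry.comp fun _ _ => rfl
  have hc : CompactSpace (Set.range (kuratowskiEmbedding K)) := e.toHomeomorph.compactSpace
  refine ⟨ULift.{w} (Set.range (kuratowskiEmbedding K)), inferInstance,
    Homeomorph.ulift.symm.compactSpace, fun t => (i t : E), isometry_subtype_coe.comp hi, ?_⟩
  have hs : Function.Surjective i := e.symm.surjective.comp ULift.down_surjective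
  change Set.range (Subtype.val ∘ i) = K
  rw [hs.range_comp, Subtype.range_coe]

/-- Every compactly supported law is the law of an embedded compact fully supported `mm`-field. -/
theorem CompactLaw.exists_pushLaw_eq {B : Type u} [MetricSpace B] {U : BField.{u, v} B}
    (μ : CompactLaw U) : ∃ (X : CompactMMField.{u, w} B) (_ : X.FullySupported)
      (ι : X.toBField → U) (hι : X.toBField.IsEmbedding U ι), X.pushLaw hι = μ := by
  obtain ⟨F, hF, i, hi, hir⟩ : ∃ (F : BField.{u, w} B) (_ : CompactSpace F) (i : F → U),
      F.IsEmbedding U i ∧ Set.range i = μ.law.support := by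
    obtain ⟨T, mT, cT, j, hj, hjr⟩ := μ.compact_support.exists_isometry_range_eq
    exact ⟨⟨T, U.proj ∘ j, by simpa using U.lipschitz.comp hj.lipschitz⟩, cT, j,
      ⟨hj, fun _ => rfl⟩, hjr⟩
  have mi := hi.isometry.measurableEmbedding_of_complete
  have hmap : (μ.law.comap i).map i = μ.law :=
    mi.map_comap_of_ae (hir ▸ Measure.support_mem_ae (μ := μ.law))
  have hprob : IsProbabilityMeasure (μ.law.comap i) := by
    constructor
    rw [← Set.preimage_univ (f := i), ← Measure.map_apply mi.measurable .univ, hmap, measure_univ]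
  let X : CompactMMField.{u, w} B := ⟨⟨F, μ.law.comap i, hprob⟩, hF⟩
  refine ⟨X, ?_, i, hi, CompactLaw.ext hmap⟩
  have h := support_map_of_isClosedEmbedding hi.isometry.isClosedEmbedding (μ.law.comap i)
  rw [hmap, ← hir, ← Set.image_univ] at h
  exact (hi.isometry.injective.image_injective h).symm

namespace BField

variable {B : Type u} [MetricSpace B] {U : BField.{u, v} B}

/-- The map that sends an `mm`-field to the orbit of its law in a Urysohn field. -/
noncomputable def IsUrysohn.lawOrbit (hU : U.IsUrysohn) : MMModuli.{u, w} B → LawOrbits U :=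
  Quotient.lift (fun X => LawOrbits.mk (X.1.pushLaw (hU.exists_isEmbedding X.1.toBField).choose_spec))
    fun _ _ h => CompactMMField.mk_pushLaw_eq_of_iso hU h _ _

theorem IsUrysohn.lawOrbit_mk (hU : U.IsUrysohn) (X : CompactMMField.{u, w} B)
    (hX : X.FullySupported) {ι : X.toBField → U} (hι : X.toBField.IsEmbedding U ι) :
    hU.lawOrbit (MMModuli.mk X hX) = LawOrbits.mk (X.pushLaw hι) :=
  X.mk_pushLaw_eq hU _ hι

theorem IsUrysohn.lawOrbit_bijective (hU : U.IsUrysohn) :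
    Function.Bijective (hU.lawOrbit : MMModuli.{u, w} B → LawOrbits U) := by
  constructor
  · intro a b h
    induction a, b using Quotient.inductionOn₂ with | _ X Y
    exact Quotient.sound (CompactMMField.iso_of_mk_pushLaw_eq X.2 Y.2 _ _ h)
  · intro a
    induction a using Quotient.inductionOn with | _ μ
    obtain ⟨X, hX, ι, hι, h⟩ := μ.exists_pushLaw_eq
    exact ⟨MMModuli.mk X hX, (hU.lawOrbit_mk X hX hι).trans (congrArg LawOrbits.mk h)⟩

/-- The quotient metric on the orbits of compactly supported laws on a Urysohn field. -/
theorem IsUrysohn.exists_metricSpace_lawOrbits (hU : U.IsUrysohn) :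
    ∃ (_ : MetricSpace (CompactLaw U)) (_ : MetricSpace (LawOrbits U)),
      (∀ μ ν : CompactLaw U, edist μ ν = wassersteinInf μ.law ν.law) ∧
      (∀ a b : LawOrbits U, edist a b =
        quotientEDist (MulAction.orbitRel U.Aut (CompactLaw U))
          (fun μ ν : CompactLaw U => edist μ ν) a b) ∧
      (∀ μ ν : CompactLaw U, edist (LawOrbits.mk μ) (LawOrbits.mk ν) =
        ⨅ g : U.Aut, wassersteinInf μ.law (g • ν).law) := by
  let m : MetricSpace (CompactLaw U) := CompactLaw.wassersteinMetric
  have : IsIsometricSMul U.Aut (CompactLaw U) := ⟨fun g μ ν => wassersteinInf_smul g μ ν⟩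
  let p : PseudoEMetricSpace (LawOrbits U) := orbitPseudoEMetric
  -- Separation of orbits is exactly their closedness.
  let e : EMetricSpace (LawOrbits U) :=
    { p with
      eq_of_edist_eq_zero := fun {a b} h => by
        induction a, b using Quotient.inductionOn₂ with | _ μ ν
        obtain ⟨g, hg⟩ := hU.exists_smul_eq_of_iInf_eq_zero h
        exact Quotient.sound (MulAction.orbitRel_apply.2 ⟨g, hg⟩) }
  have hfin : ∀ a b : LawOrbits U, edist a b ≠ ⊤ := fun a b => by
    induction a, b using Quotient.inductionOn₂ with | _ μ ν
    exact ne_top_of_le_ne_top (CompactLaw.wassersteinInf_ne_top μ (1 • ν)) (iInf_le _ (1 : U.Aut))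
  exact ⟨m, EMetricSpace.toMetricSpace hfin, fun _ _ => rfl,
    fun a b => (quotientEDist_orbitRel a b).symm, fun _ _ => rfl⟩

end BField

theorem theorem5p5 {B : Type u} [MetricSpace B] [CompleteSpace B] [SeparableSpace B]
    (U : BField.{u, v} B) (hU : U.IsUrysohn) :
    ∃ (_ : MetricSpace (MMModuli.{u, w} B)) (_ : MetricSpace (CompactLaw U))
      (_ : MetricSpace (LawOrbits U)),
      -- the three metrics: the Gromov-Wasserstein, the Wasserstein and the quotient metric
      (∀ (X Y : CompactMMField.{u, w} B) (hX : X.FullySupported) (hY : Y.FullySupported),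
        edist (MMModuli.mk X hX) (MMModuli.mk Y hY) =
          X.toMMField.gromovWassersteinInf Y.toMMField) ∧
      (∀ μ ν : CompactLaw U, edist μ ν = wassersteinInf μ.law ν.law) ∧
      (∀ a b : LawOrbits U, edist a b =
        quotientEDist (MulAction.orbitRel U.Aut (CompactLaw U))
          (fun μ ν : CompactLaw U => edist μ ν) a b) ∧
      (∀ μ ν : CompactLaw U, edist (LawOrbits.mk μ) (LawOrbits.mk ν) =
        ⨅ g : U.Aut, wassersteinInf μ.law (g • ν).law) ∧
      -- every compact field embeds, and pushing forward the law induces an isometry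
      (∀ X : CompactMMField.{u, w} B, ∃ ι : X.toBField → U, X.toBField.IsEmbedding U ι) ∧
      (∃ Ψ : MMModuli.{u, w} B ≃ᵢ LawOrbits U,
        ∀ (X : CompactMMField.{u, w} B) (hX : X.FullySupported) (ι : X.toBField → U)
          (hι : X.toBField.IsEmbedding U ι),
          Ψ (MMModuli.mk X hX) =
            LawOrbits.mk (X.compactLaw.map ι hι.isometry.continuous)) ∧
      -- distances are preserved also without full support
      (∀ (X Y : CompactMMField.{u, w} B) (ι : X.toBField → U) (κ : Y.toBField → U)
        (hι : X.toBField.IsEmbedding U ι) (hκ : Y.toBField.IsEmbedding U κ),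
        edist (LawOrbits.mk (X.compactLaw.map ι hι.isometry.continuous))
            (LawOrbits.mk (Y.compactLaw.map κ hκ.isometry.continuous)) =
          X.toMMField.gromovWassersteinInf Y.toMMField) := by
  obtain ⟨m, m', h1, h2, h3⟩ := hU.exists_metricSpace_lawOrbits
  have h4 : ∀ (X Y : CompactMMField.{u, w} B) (ι : X.toBField → U) (κ : Y.toBField → U)
      (hι : X.toBField.IsEmbedding U ι) (hκ : Y.toBField.IsEmbedding U κ),
      edist (LawOrbits.mk (X.pushLaw hι)) (LawOrbits.mk (Y.pushLaw hκ)) =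
        X.toMMField.gromovWassersteinInf Y.toMMField := fun X Y ι κ hι hκ => by
    rw [h3, CompactMMField.iInf_wassersteinInf_eq hU X Y hι hκ]
  -- The metric on the moduli space is pulled back along the bijection, so its axioms need no
  -- separate proof; `h4` identifies it with the Gromov-Wasserstein distance.
  let n : MetricSpace (MMModuli.{u, w} B) :=
    MetricSpace.induced hU.lawOrbit hU.lawOrbit_bijective.injective m'
  refine ⟨n, m, m', fun X Y hX hY => ?_, h1, h2, h3, fun X => hU.exists_isEmbedding X.toBField,
    ⟨⟨Equiv.ofBijective hU.lawOrbit hU.lawOrbit_bijective, fun _ _ => rfl⟩,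
      fun X hX ι hι => hU.lawOrbit_mk X hX hι⟩, h4⟩
  obtain ⟨ι, hι⟩ := hU.exists_isEmbedding X.toBField
  obtain ⟨κ, hκ⟩ := hU.exists_isEmbedding Y.toBField
  rw [← h4 X Y ι κ hι hκ, ← hU.lawOrbit_mk X hX hι, ← hU.lawOrbit_mk Y hY hκ]
  rfl
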